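/- Let $\mathbb{F}$ be a finite field with $q$ elements, let $\mathbb{L}/\mathbb{F}$ be a field extension of finite degree $r$, and let $\Phi : x \mapsto x^q$ be the Frobenius automorphism of $\mathbb{L}$. Let $m \ge 1$ and let $\underline e = (e_1,\dots,e_m) \in \mathbb{Z}^m$ with $\gcd(e_1,\dots,e_m,r) = 1$. For $\underline u \in \mathbb{Z}^m$ write $\underline e\cdot\underline u = e_1u_1+\dots+e_mu_m$, and let $L = \{\underline u \in \mathbb{Z}^m : \underline e\cdot \underline u \in r\mathbb{Z}\}$. Let $\mathbb{L}[\underline X^{\pm1};\underline\theta]$ be the ring of multivariate Ore Laurent polynomials, i.e. of finite sums $\sum_{\underline u\in\mathbb{Z}^m} a_{\underline u} \underline X^{\underline u}$ with $a_{\underline u} \in \mathbb{L}$, in which the variables $X_1,\dots,X_m$ commute with each other and $X_i a = \Phi^{e_i}(a) X_i$ for $a \in \mathbb{L}$. Let $H$ be the (finite) set of group homomorphisms $\gamma : L \to \mathbb{F}^\times$. For every $\gamma\in H$ fix any extension of $\gamma$ to a function $\tilde\gamma : \mathbb{Z}^m \to \mathbb{L}^\times$ with $\tilde\gamma(\underline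 u+\underline v) = \tilde\gamma(\underline u)\,\Phi^{\underline e\cdot\underline u}(\tilde\gamma(\underline v))$ for all $\underline u, \underline v$ (such extensions exist), and let $$\epsilon_{\tilde\gamma} : \mathbb{L}[\underline X^{\pm1};\underline\theta] \to \mathrm{End}_{\mathbb{F}}(\mathbb{L}), \qquad \sum_{\underline u} a_{\underline u}\underline X^{\underline u} \mapsto \sum_{\underline u} a_{\underline u}\,\tilde\gamma(\underline u)\,\Phi^{\underline e\cdot\underline u}.$$ Put $\epsilon = (\epsilon_{\tilde\gamma})_{\gamma\in H}$, a map to $\mathcal{H} = \prod_{\gamma\in H}\mathrm{End}_{\mathbb{F}}(\mathbb{L})$. This is an $\mathbb{L}$-vector space through $(a\varphi)(x) = a\,\varphi(x)$, and $\epsilon$ is $\mathbb{L}$-linear. The sum-rank weight of $(\varphi_\gamma)_\gamma\in\mathcal{H}$ is $\sum_{\gamma\in H}\dim_{\mathbb{F}}\varphi_\gamma(\mathbb{L})$. For a positive integer $\delta$, the linearized Reed–Muller code $\mathrm{LRM}(\underline e;\delta)\subseteq\mathcal{H}$ is the image under $\epsilon$ of the $\mathbb{L}$-space of Ore polynomials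 with nonnegative exponents and total degree at most $\delta$, i.e. of the $\mathbb{L}$-span of the $\underline X^{\underline u}$ with $\underline u\in\mathbb{Z}_{\ge0}^m$ and $u_1+\dots+u_m\le\delta$. **Theorem.** If $1\le\delta\le q-2$, then the $\mathbb{L}$-dimension $k$ of $\mathrm{LRM}(\underline e;\delta)$ and its minimum distance $d$ (the least sum-rank weight of a nonzero codeword) satisfy $$k = \binom{\delta+m}{\delta} \qquad\text{and}\qquad d \ge r\,(q-1)^{m-1}(q-1-\delta).$$ -/

import Mathlib

open Module

noncomputable section

/-! ## Sum-rank metric codes -/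

namespace SumRank

variable {F K H : Type*} [Field F] [Field K] [Algebra F K] [Fintype H]

/-- The sum-rank weight `∑ rk (φ i)` of a tuple `φ` of `F`-linear endomorphisms of `K`. -/
def weight (φ : H → Module.End F K) : ℕ :=
  ∑ i, finrank F (LinearMap.range (φ i))

/-- The minimum distance of a `K`-linear code `C ⊆ ∏ End_F(K)`: the minimum of the sum-rank weights
of the nonzero codewords. Here `a : K` acts on `Module.End F K` by `(a • f) x = a * f x`. -/
def minDist (C : Submodule K (H → Module.End F K)) : ℕ :=
  sInf {w | ∃ φ ∈ C, φ ≠ 0 ∧ weight φ = w}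

end SumRank

/-! ## Multivariate Ore (Laurent) polynomials over an extension `K / F` of finite fields -/

namespace Ore

variable (F K : Type*) [Field F] [Fintype F] [Field K] [Algebra F K] [FiniteDimensional F K]
variable {m : ℕ} (e : Fin m → ℤ)

/-- The Frobenius automorphism `Φ : x ↦ x ^ q` of `K`, where `q` is the cardinality of `F`. -/
abbrev frob : K ≃ₐ[F] K := FiniteField.frobeniusAlgEquivOfAlgebraic F K

/-- The group `ℤ^m` of exponents `u`, written multiplicatively (`u` stands for the monomial `X^u`)
and acting on `K` through `Φ ^ (e ⬝ u)`. -/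
def Exponent (_F _K : Type*) {m : ℕ} (_e : Fin m → ℤ) : Type := Multiplicative (Fin m → ℤ)

instance : CommGroup (Exponent F K e) :=
  inferInstanceAs (CommGroup (Multiplicative (Fin m → ℤ)))

/-- The homomorphism `u ↦ Φ ^ (e ⬝ u)` from `ℤ^m` to the Galois group. -/
def frobPow : Exponent F K e →* (K ≃ₐ[F] K) where
  toFun u := frob F K ^ (e ⬝ᵥ Multiplicative.toAdd u)
  map_one' := by
    change frob F K ^ (e ⬝ᵥ (0 : Fin m → ℤ)) = 1
    simp
  map_mul' u v := by
    change frob F K ^ (e ⬝ᵥ (Multiplicative.toAdd u + Multiplicative.toAdd v)) = _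
    rw [dotProduct_add, zpow_add]

instance : MulSemiringAction (Exponent F K e) K :=
  MulSemiringAction.compHom K (frobPow F K e)

/-- The ring `K[X₁^±1, …, X_m^±1; Φ^e₁, …, Φ^e_m]` of multivariate Ore Laurent polynomials: finite
sums `∑ a_u X^u` with `u ∈ ℤ^m`, multiplied by the rule
`(a X^u) * (b X^v) = a * Φ^(e ⬝ u) b X^(u + v)`. -/
abbrev Laurent : Type _ := SkewMonoidAlgebra K (Exponent F K e)

/-- The monomial term `a X^u`. -/
def term (u : Fin m → ℤ) (a : K) : Laurent F K e :=
  SkewMonoidAlgebra.single (show Exponent F K e from Multiplicative.ofAdd u) a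

theorem term_mul_term (u v : Fin m → ℤ) (a b : K) :
    term F K e u a * term F K e v b
      = term F K e (u + v) (a * (frob F K ^ (e ⬝ᵥ u)) b) :=
  SkewMonoidAlgebra.single_mul_single

/-- The coefficient `a_u` of `X^u`. -/
def coeff (f : Laurent F K e) (u : Fin m → ℤ) : K :=
  SkewMonoidAlgebra.coeff f (show Exponent F K e from Multiplicative.ofAdd u)

/-- The `K`-space of Ore polynomials (no negative exponents) of total degree at most `d`. -/
def degreeLE (d : ℕ) : Submodule K (Laurent F K e) where
  carrier := {f | ∀ u, coeff F K e f u ≠ 0 → (∀ i, 0 ≤ u i) ∧ ∑ i, u i ≤ d}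
  zero_mem' u hu := absurd rfl hu
  add_mem' {f g} hf hg u hu := by
    by_cases h : coeff F K e f u = 0
    · refine hg u fun h' => hu ?_
      unfold coeff at h h' ⊢
      rw [SkewMonoidAlgebra.coeff_add, Finsupp.add_apply, h, h', add_zero]
    · exact hf u h
  smul_mem' c f hf u hu := by
    refine hf u fun h => hu ?_
    unfold coeff at h ⊢
    rw [SkewMonoidAlgebra.coeff_smul, Finsupp.smul_apply, h, smul_zero]

/-- The lattice `L = {u ∈ ℤ^m | e ⬝ u ∈ r ℤ}`, where `r = [K : F]`. -/
def lattice : AddSubgroup (Fin m → ℤ) where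
  carrier := {u | (finrank F K : ℤ) ∣ e ⬝ᵥ u}
  zero_mem' := by simp
  add_mem' {u v} hu hv := by
    change _ ∣ e ⬝ᵥ (u + v)
    rw [dotProduct_add]
    exact dvd_add hu hv
  neg_mem' {u} hu := by
    change _ ∣ e ⬝ᵥ (-u)
    rw [dotProduct_neg]
    exact (dvd_neg).2 hu

/-- The set `H` of group homomorphisms from `L` to `F^×`. -/
abbrev Character : Type _ := Multiplicative (lattice F K e) →* Fˣ

instance : Finite (Character F K e) := by
  have h1 : (AddSubgroup.toIntSubmodule (lattice F K e)).FG := IsNoetherian.noetherian _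
  obtain ⟨S, hS⟩ := (Submodule.fg_iff_addSubgroup_fg _).1 h1
  have hS' : AddSubgroup.closure (S : Set (Fin m → ℤ)) = lattice F K e := hS
  have hsub : ∀ s ∈ S, s ∈ lattice F K e := fun s hs => hS' ▸ AddSubgroup.subset_closure hs
  refine Finite.of_injective (β := S → Fˣ)
    (fun γ s => γ (Multiplicative.ofAdd ⟨s.1, hsub s.1 s.2⟩)) fun γ γ' h => ?_
  have key : ∀ u (hu : u ∈ AddSubgroup.closure (S : Set (Fin m → ℤ))),
      γ (Multiplicative.ofAdd ⟨u, hS' ▸ hu⟩) = γ' (Multiplicative.ofAdd ⟨u, hS' ▸ hu⟩) := by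
    intro u hu
    induction hu using AddSubgroup.closure_induction with
    | mem x hx => exact congrFun h ⟨x, hx⟩
    | zero => exact (map_one γ).trans (map_one γ').symm
    | add x y hx hy h1 h2 =>
      have := congrArg₂ (· * ·) h1 h2
      simp only [← map_mul] at this
      exact this
    | neg x hx h1 =>
      have := congrArg (·⁻¹) h1
      simp only [← map_inv] at this
      exact this
  refine MonoidHom.ext fun u => ?_
  exact key u.toAdd.1 (hS'.symm ▸ u.toAdd.2)

instance : Fintype (Character F K e) := Fintype.ofFinite _

variable {F K e}

/-- A prolongation of `γ : L → F^×` to a `1`-cocycle `ℤ^m → K^×`. -/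
structure Prolongation (γ : Character F K e) where
  /-- The underlying function. -/
  toFun : (Fin m → ℤ) → Kˣ
  /-- It extends `γ`. -/
  extends_char : ∀ u : lattice F K e,
    (toFun u : K) = algebraMap F K (γ (Multiplicative.ofAdd u) : F)
  /-- The cocycle condition. -/
  cocycle : ∀ u v : Fin m → ℤ,
    (toFun (u + v) : K) = toFun u * (frob F K ^ (e ⬝ᵥ u)) (toFun v : K)

/-- The evaluation morphism `∑ a_u X^u ↦ ∑ a_u γ'(u) Φ^(e ⬝ u)` at a prolongation `γ'` of `γ`. -/
def eval {γ : Character F K e} (γ' : Prolongation γ) : Laurent F K e →ₗ[K] Module.End F K :=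
  SkewMonoidAlgebra.basisSingleOne.constr K fun u : Exponent F K e =>
    (γ'.toFun (Multiplicative.toAdd u) : K) •
      (frob F K ^ (e ⬝ᵥ Multiplicative.toAdd u)).toLinearMap

theorem eval_term {γ : Character F K e} (γ' : Prolongation γ) (u : Fin m → ℤ) (a x : K) :
    eval γ' (term F K e u a) x = a * γ'.toFun u * (frob F K ^ (e ⬝ᵥ u)) x := by
  have h : term F K e u a = a • SkewMonoidAlgebra.basisSingleOne
      (show Exponent F K e from Multiplicative.ofAdd u) := by
    change _ = a • SkewMonoidAlgebra.single _ (1 : K)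
    rw [SkewMonoidAlgebra.smul_single, smul_eq_mul, mul_one]
    rfl
  rw [h, map_smul, eval, Basis.constr_basis, mul_assoc]
  rfl

/-- The evaluation is multiplicative on terms. -/
theorem eval_mul_term {γ : Character F K e} (γ' : Prolongation γ) (u v : Fin m → ℤ)
    (a b : K) : eval γ' (term F K e u a * term F K e v b) =
      eval γ' (term F K e u a) * eval γ' (term F K e v b) := by
  ext x
  rw [term_mul_term, Module.End.mul_apply]
  simp only [eval_term, γ'.cocycle, dotProduct_add, zpow_add, AlgEquiv.mul_apply, map_mul]
  ring

/-- A cocycle `ℤ → K^×` with prescribed value at `1`. -/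
theorem exists_zcocycle (α : Kˣ) : ∃ n : ℤ → Kˣ,
    (∀ a b, (n (a + b) : K) = n a * (frob F K ^ a) (n b : K)) ∧ n 0 = 1 ∧ n 1 = α := by
  let ψ : (K ≃ₐ[F] K) →* MulAut Kˣ :=
    { toFun := fun σ => Units.mapEquiv σ.toMulEquiv
      map_one' := by ext; rfl
      map_mul' := fun _ _ => by ext; rfl }
  let t : Kˣ ⋊[ψ] (K ≃ₐ[F] K) := ⟨α, frob F K⟩
  have hr : ∀ a : ℤ, (t ^ a).right = frob F K ^ a := fun a =>
    map_zpow (SemidirectProduct.rightHom (φ := ψ)) t a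
  refine ⟨fun a => (t ^ a).left, fun a b => ?_, by simp, by simp [t]⟩
  simp only [zpow_add, SemidirectProduct.mul_left, hr, Units.val_mul]
  rfl

/-- Prolongations exist. -/
theorem nonempty_prolongation
    (he : Int.gcd (Finset.univ.gcd e) (Module.finrank F K : ℤ) = 1) (γ : Character F K e) :
    Nonempty (Prolongation γ) := by
  have hfin : Finite K := Module.finite_of_finite F
  set r : ℤ := ((finrank F K : ℕ) : ℤ) with hr
  obtain ⟨v, k, hv⟩ : ∃ v : Fin m → ℤ, ∃ k : ℤ, e ⬝ᵥ v = 1 + r * k := by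
    obtain ⟨f, hf⟩ := Finset.gcd_eq_sum_mul Finset.univ e
    have h := Int.gcd_eq_gcd_ab (Finset.univ.gcd e) r
    rw [he, hf] at h
    refine ⟨fun i => f i * Int.gcdA (∑ i, e i * f i) r, - Int.gcdB (∑ i, e i * f i) r, ?_⟩
    simp only [dotProduct, ← mul_assoc, ← Finset.sum_mul]
    push_cast at h
    linarith
  have hrv : r • v ∈ lattice F K e := by
    change r ∣ e ⬝ᵥ (r • v)
    rw [dotProduct_smul]; exact ⟨_, rfl⟩
  have hl : ∀ u : Fin m → ℤ, u - (e ⬝ᵥ u) • v ∈ lattice F K e := fun u => by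
    change r ∣ e ⬝ᵥ _
    rw [dotProduct_sub, dotProduct_smul, hv, smul_eq_mul]
    exact ⟨- (e ⬝ᵥ u) * k, by ring⟩
  obtain ⟨α, hα⟩ := FiniteField.unitsMap_norm_surjective F K (γ (Multiplicative.ofAdd ⟨_, hrv⟩))
  obtain ⟨n, hn, hn0, hn1⟩ := exists_zcocycle (F := F) α
  -- values of the cocycle
  have hnat : ∀ j : ℕ, (n j : K) = ∏ i ∈ Finset.range j, (frob F K ^ i) (α : K) := by
    intro j
    induction j with
    | zero => simp [hn0]
    | succ j ih => rw [Nat.cast_succ, hn, ih, Finset.prod_range_succ, hn1, zpow_natCast]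
  have hfr : frob F K ^ r = 1 := by
    rw [hr, zpow_natCast, ← FiniteField.orderOf_frobeniusAlgEquivOfAlgebraic F K, pow_orderOf_eq_one]
  have hnr : (n r : K) = algebraMap F K (γ (Multiplicative.ofAdd ⟨_, hrv⟩) : F) := by
    rw [← hα, Units.coe_map, Algebra.norm_eq_prod_automorphisms,
      ← (FiniteField.bijective_frobeniusAlgEquivOfAlgebraic_pow F K).prod_comp, hr, hnat,
      Finset.prod_range]
  let ι : F →* K := algebraMap F K
  have hmul : ∀ c : ℤ, n (r * c) = (Units.map ι (γ (Multiplicative.ofAdd ⟨_, hrv⟩))) ^ c := by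
    let N : Multiplicative ℤ →* Kˣ :=
      { toFun := fun c => n (r * c.toAdd)
        map_one' := by simp [hn0]
        map_mul' := fun a b => by
          ext
          simp [mul_add, hn, zpow_mul, hfr] }
    intro c
    have h := map_zpow N (Multiplicative.ofAdd 1) c
    rw [← ofAdd_zsmul] at h
    have h2 : N (Multiplicative.ofAdd 1) = Units.map ι (γ (Multiplicative.ofAdd ⟨_, hrv⟩)) := by
      ext; simp [N, hnr, ι]
    rw [h2] at h
    simpa [N] using h
  refine ⟨⟨fun u => Units.map ι (γ (Multiplicative.ofAdd ⟨_, hl u⟩)) * n (e ⬝ᵥ u), ?_, ?_⟩⟩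
  · rintro ⟨u, c, hc⟩
    change e ⬝ᵥ u = r * c at hc
    have hu : (⟨u, ⟨c, hc⟩⟩ : lattice F K e) = ⟨_, hl u⟩ + c • ⟨_, hrv⟩ := by
      ext i; simp [hc]; ring
    have h2 : γ (Multiplicative.ofAdd ⟨u, ⟨c, hc⟩⟩) =
        γ (Multiplicative.ofAdd ⟨_, hl u⟩) * γ (Multiplicative.ofAdd ⟨_, hrv⟩) ^ c := by
      rw [← map_zpow, ← map_mul, ← ofAdd_zsmul, ← ofAdd_add]
      exact congrArg (fun z => γ (Multiplicative.ofAdd z)) hu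
    have h3 : n (e ⬝ᵥ u) = Units.map ι (γ (Multiplicative.ofAdd ⟨_, hrv⟩) ^ c) := by
      rw [map_zpow, ← hmul, hc]
    change ((Units.map ι (γ (Multiplicative.ofAdd ⟨_, hl u⟩)) * n (e ⬝ᵥ u) : Kˣ) : K) = _
    rw [h3, ← map_mul, ← h2]
    rfl
  · intro u w
    have huw : (⟨_, hl (u + w)⟩ : lattice F K e) = ⟨_, hl u⟩ + ⟨_, hl w⟩ := by
      ext i; simp [dotProduct_add]; ring
    rw [huw, ofAdd_add, map_mul, map_mul, dotProduct_add]
    simp only [Units.val_mul, hn, map_mul, Units.coe_map, ι, MonoidHom.coe_coe, AlgEquiv.commutes]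
    ring

/-- The multievaluation morphism, for a fixed choice of a prolongation of every `γ ∈ H`. -/
def multiEval (γ' : ∀ γ : Character F K e, Prolongation γ) :
    Laurent F K e →ₗ[K] (Character F K e → Module.End F K) :=
  LinearMap.pi fun γ => eval (γ' γ)

/-- The linearized Reed–Muller code `LRM(e; d)`, for a fixed choice of the prolongations. -/
def LRM (γ' : ∀ γ : Character F K e, Prolongation γ) (d : ℕ) :
    Submodule K (Character F K e → Module.End F K) :=
  (degreeLE F K e d).map (multiEval γ')

end Ore

end

noncomputable section

/-! ## Triangular bases of congruence lattices -/

/-! Put n = q - 1 and let E(u) be the image of X^u. Every unit of F is killed by n, so E(u) depends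
only on u modulo nL. Conversely, pairwise incongruent exponents have K-independent images
(`linearIndependent_monomialEval`): apply Dedekind independence first to the automorphisms of K,
then to the characters of H given by evaluation at points of L. Exponents of degree at most δ < n
are incongruent, which gives k.

For d, the weight of φ bounds the number of independent left multiples of φ
(`SumRank.card_le_weight`), so many are needed. A triangular basis of L with diagonal d_i, of
product r because the gcd is 1, makes the box ∏ [0, n d_i) a set of representatives modulo nL.
Reduction into it never increases an exponent lexicographically (`exists_lex_reduction`). If a is
the lex-leading exponent of f, then X^u f keeps the leading term E(u + a) whenever u + a is in the
box, so these multiples are independent (`linearIndependent_shift`). There are ∏ (n d_i - a_i) such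
u, and `le_card_box` bounds this below. -/

/-- The lattice `{u | r ∣ e ⬝ u}` has a triangular basis; the product of its diagonal entries is `r / g`
with `g` the greatest common divisor of `r` and of the entries of `e`. -/
theorem exists_triangular_diagonal {r : ℕ} (hr : 0 < r) {m : ℕ} (e : Fin m → ℤ) :
    ∃ (d : Fin m → ℕ) (g : ℕ), (∏ i, d i) * g = r ∧ (∀ i, (g : ℤ) ∣ e i) ∧
      (∃ x : Fin m → ℤ, ∃ y : ℤ, e ⬝ᵥ x + r * y = g) ∧
      (∀ i, ∃ b : Fin m → ℤ, (r : ℤ) ∣ e ⬝ᵥ b ∧ b i = d i ∧ ∀ j < i, b j = 0) ∧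
      ∀ u : Fin m → ℤ, (r : ℤ) ∣ e ⬝ᵥ u → ∀ i, (∀ j < i, u j = 0) → (d i : ℤ) ∣ u i := by
  induction m with
  | zero =>
    exact ⟨fun _ => 1, r, by simp, fun i => i.elim0, ⟨0, 1, by simp⟩, fun i => i.elim0,
      fun _ _ i => i.elim0⟩
  | succ m ih =>
    have dot : ∀ u : Fin (m + 1) → ℤ, e ⬝ᵥ u = e 0 * u 0 + Fin.tail e ⬝ᵥ Fin.tail u :=
      fun u => Fin.sum_univ_succ _
    obtain ⟨d, g, hd, hg, ⟨x, y, hxy⟩, hb, hu⟩ := ih (Fin.tail e)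
    have hg0 : 0 < g := Nat.pos_of_ne_zero fun h => by simp [h] at hd; omega
    have hgcd : 0 < Int.gcd (e 0) g := Int.gcd_pos_of_ne_zero_right _ (by exact_mod_cast hg0.ne')
    -- The new gcd is g' = gcd(e₀, g), with e₀ = c g' and g = d' g'. The new diagonal entry is d'
    -- because g ∣ e₀ u₀ exactly when d' ∣ u₀.
    obtain ⟨g', c, d', hg', hcop, hc, hd'⟩ := Int.exists_gcd_one' hgcd
    have hd'0 : 0 ≤ d' := by
      by_contra h
      have : d' * (g' : ℤ) < 0 := mul_neg_of_neg_of_pos (by omega) (by exact_mod_cast hg')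
      omega
    lift d' to ℕ using hd'0
    have hg'z : (g' : ℤ) ≠ 0 := by exact_mod_cast hg'.ne'
    have hgr : (g : ℤ) ∣ r := ⟨(∏ i, d i : ℕ), by rw [← hd]; push_cast; ring⟩
    refine ⟨Fin.cons d' d, g', ?_, ?_, ?_, ?_, ?_⟩
    · have h1 : g = d' * g' := by exact_mod_cast hd'
      rw [Fin.prod_univ_succ]
      simp only [Fin.cons_zero, Fin.cons_succ]
      rw [← hd, h1]
      ring
    · refine Fin.cases ⟨c, by rw [hc]; ring⟩ fun i => ?_
      exact (show (g' : ℤ) ∣ g from ⟨d', by rw [hd']; ring⟩).trans (hg i)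
    · obtain ⟨A, B, hAB⟩ := Int.isCoprime_iff_gcd_eq_one.2 hcop
      refine ⟨Fin.cons A (B • x), B * y, ?_⟩
      rw [dot, Fin.cons_zero, Fin.tail_cons, dotProduct_smul, smul_eq_mul, hc]
      linear_combination B * hxy + (g' : ℤ) * hAB + B * hd'
    · refine Fin.cases ?_ fun i => ?_
      -- Here e₀ d' = c g, and the Bézout vector x represents g modulo r, so subtracting c x cancels
      -- it.
      · refine ⟨Fin.cons d' (-c • x), ⟨c * y, ?_⟩, rfl, fun j hj => absurd hj (Fin.not_lt_zero j)⟩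
        rw [dot, Fin.cons_zero, Fin.tail_cons, dotProduct_smul, smul_eq_mul, hc]
        linear_combination (-c) * hxy - c * hd'
      · obtain ⟨b, hb1, hb2, hb3⟩ := hb i
        refine ⟨Fin.cons 0 b, ?_, by simpa using hb2, ?_⟩
        · rw [dot, Fin.cons_zero, Fin.tail_cons, mul_zero, zero_add]
          exact hb1
        · refine Fin.cases (fun _ => rfl) fun j hj => ?_
          simpa using hb3 j (Fin.succ_lt_succ_iff.1 hj)
    · intro u hru
      rw [dot] at hru
      refine Fin.cases (fun _ => ?_) fun i hi => ?_
      · rw [Fin.cons_zero]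
        have h1 : (g : ℤ) ∣ e 0 * u 0 := by
          refine (dvd_add_left ?_).1 (hgr.trans hru)
          exact Finset.dvd_sum fun i _ => (hg i).mul_right _
        rw [hd', hc, show c * (g' : ℤ) * u 0 = c * u 0 * g' by ring] at h1
        have h2 := Int.dvd_of_mul_dvd_mul_right hg'z h1
        exact (Int.isCoprime_iff_gcd_eq_one.2 hcop).symm.dvd_of_dvd_mul_left h2
      · have h0 : u 0 = 0 := hi 0 (Fin.succ_pos i)
        rw [h0, mul_zero, zero_add] at hru
        rw [Fin.cons_succ]
        exact hu (Fin.tail u) hru i fun j hj => hi _ (Fin.succ_lt_succ_iff.2 hj)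

/-! ### Boxes as representatives modulo multiples of a lattice -/

/-- A vector of natural numbers, as a vector of integers. -/
def intVec {m : ℕ} (v : Fin m → ℕ) : Fin m → ℤ := fun i => v i

theorem intVec_add {m : ℕ} (v w : Fin m → ℕ) : intVec (v + w) = intVec v + intVec w := by
  ext i; simp [intVec]

theorem intVec_injective {m : ℕ} : Function.Injective (intVec (m := m)) := fun v w h => by
  ext i
  exact Nat.cast_injective (R := ℤ) (congrFun h i)

/-- Modulo `n L`, every vector of natural numbers can be reduced into a box given by a triangular
basis of `L`, without increasing it lexicographically. -/
theorem exists_lex_reduction {m r n : ℕ} (hr : 0 < r) (hn : 0 < n) (L : AddSubgroup (Fin m → ℤ))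
    (hL : ∀ u : Fin m → ℤ, (r : ℤ) • u ∈ L) (d : Fin m → ℕ) (hd : ∀ i, 0 < d i)
    (hb : ∀ i, ∃ b ∈ L, b i = d i ∧ ∀ j < i, b j = 0) (v : Lex (Fin m → ℕ)) :
    ∃ w : Lex (Fin m → ℕ), (∀ i, ofLex w i < n * d i) ∧ w ≤ v ∧
      ∃ l ∈ L, intVec (ofLex v) = (n : ℤ) • l + intVec (ofLex w) := by
  induction v using WellFoundedLT.induction with
  | ind v ih =>
  by_cases hv : ∀ i, ofLex v i < n * d i
  · exact ⟨v, hv, le_rfl, 0, L.zero_mem, by simp⟩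
  push Not at hv
  obtain ⟨i, hi⟩ := hv
  obtain ⟨b, hbL, hbi, hbj⟩ := hb i
  have hnr : (0 : ℤ) < n * r := by exact_mod_cast Nat.mul_pos hn hr
  -- Subtracting n b lowers entry i by n d_i and fixes the earlier ones. Later entries could become
  -- negative, so they are replaced by residues modulo n r, allowed since r ℤ^m ⊆ L; the
  -- lexicographic order ignores them.
  let t : Fin m → ℤ := fun j => if i < j then (ofLex v j - n * b j) / (n * r) else 0
  let w : Fin m → ℕ := fun j => (ofLex v j - n * b j - n * r * t j).toNat
  have hw : ∀ j, (w j : ℤ) = ofLex v j - n * b j - n * r * t j := fun j => by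
    refine Int.toNat_of_nonneg ?_
    rcases lt_trichotomy i j with h | rfl | h
    · simp only [t, if_pos h]
      linarith [Int.emod_nonneg (ofLex v j - n * b j : ℤ) hnr.ne',
        Int.emod_add_mul_ediv (ofLex v j - n * b j : ℤ) (n * r)]
    · simp only [t, lt_irrefl, if_false, hbi]
      have : ((n * d i : ℕ) : ℤ) ≤ ofLex v i := by exact_mod_cast hi
      push_cast at this
      linarith
    · simp [t, not_lt.2 h.le, hbj j h]
  have hlt : toLex w < v := by
    refine ⟨i, fun j hj => ?_, ?_⟩
    · have := hw j
      simp only [t, not_lt.2 hj.le, if_false, hbj j hj] at this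
      have h2 : (w j : ℤ) = ofLex v j := by linarith
      exact_mod_cast h2
    · have := hw i
      simp only [t, lt_irrefl, if_false, hbi] at this
      have h3 : (0 : ℤ) < n * d i := by exact_mod_cast Nat.mul_pos hn (hd i)
      have h2 : (w i : ℤ) < ofLex v i := by linarith
      exact_mod_cast h2
  obtain ⟨w', h1, h2, l, hl, h3⟩ := ih _ hlt
  refine ⟨w', h1, h2.trans hlt.le, l + (b + (r : ℤ) • t),
    L.add_mem hl (L.add_mem hbL (hL t)), ?_⟩
  ext j
  have h4 := congrFun h3 j
  have h5 := hw j
  simp only [intVec, ofLex_toLex, Pi.add_apply, Pi.smul_apply, smul_eq_mul] at h4 ⊢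
  linarith

/-- The box given by a triangular basis of `L` meets every class modulo `n L` at most once. -/
theorem eq_of_sub_mem_of_lt {m n : ℕ} (L : AddSubgroup (Fin m → ℤ)) (d : Fin m → ℕ)
    (hu : ∀ u ∈ L, ∀ i, (∀ j < i, u j = 0) → (d i : ℤ) ∣ u i) {v w : Fin m → ℕ}
    (hv : ∀ i, v i < n * d i) (hw : ∀ i, w i < n * d i) {l : Fin m → ℤ} (hl : l ∈ L)
    (h : intVec v = (n : ℤ) • l + intVec w) : v = w := by
  have hi : ∀ i, (v i : ℤ) = n * l i + w i := fun i => congrFun h i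
  have key : ∀ i, l i = 0 := by
    intro i
    induction i using WellFoundedLT.induction with
    | ind i ih =>
    -- Once the earlier entries of l vanish, v_i and w_i differ by n d_i c and both lie in [0, n
    -- d_i), so c = 0.
    obtain ⟨c, hc⟩ := hu l hl i ih
    have h1 := hi i
    have h2 : (v i : ℤ) < n * d i := by exact_mod_cast hv i
    have h3 : (w i : ℤ) < n * d i := by exact_mod_cast hw i
    have h4 : (0 : ℤ) ≤ v i := by positivity
    have h5 : (0 : ℤ) ≤ w i := by positivity
    have h6 : (v i : ℤ) = n * d i * c + w i := by rw [h1, hc]; ring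
    have hpos : (0 : ℤ) < n * d i := by omega
    have h7 : c < 1 := by
      by_contra hlt
      have := mul_le_mul_of_nonneg_left (not_lt.1 hlt) hpos.le
      linarith
    have h8 : -1 < c := by
      by_contra hlt
      have := mul_le_mul_of_nonneg_left (not_lt.1 hlt) hpos.le
      linarith
    have : c = 0 := by omega
    rw [hc, this, mul_zero]
  ext i
  have := hi i
  rw [key i, mul_zero, zero_add] at this
  exact_mod_cast this

/-! ## Counting -/

/-- A Weierstrass product inequality; the extra factor n on the right avoids the exponent `s.card -
1`. Each induction step gains n^|s| a_i ∑ a_j ≥ 0. -/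
theorem pow_mul_sub_sum_le_prod_sub {ι : Type*} (s : Finset ι) (n : ℤ) (hn : 0 ≤ n) (a : ι → ℤ)
    (ha : ∀ i ∈ s, 0 ≤ a i) (hs : ∑ i ∈ s, a i ≤ n) :
    n ^ s.card * (n - ∑ i ∈ s, a i) ≤ n * ∏ i ∈ s, (n - a i) := by
  classical
  induction s using Finset.induction_on with
  | empty => simp
  | insert i s his ih =>
    rw [Finset.sum_insert his] at hs ⊢
    rw [Finset.card_insert_of_notMem his, Finset.prod_insert his]
    have hi := ha i (Finset.mem_insert_self i s)
    have hs' : ∀ j ∈ s, 0 ≤ a j := fun j hj => ha j (Finset.mem_insert_of_mem hj)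
    have hsum := Finset.sum_nonneg hs'
    have h := mul_le_mul_of_nonneg_left (ih hs' (by linarith)) (show 0 ≤ n - a i by linarith)
    have hp : 0 ≤ n ^ s.card * (a i * ∑ j ∈ s, a j) := by positivity
    rw [pow_succ]
    linarith

/-- The number of points of a box with sides `n d_i` that dominate a vector `a` with `∑ a_i ≤ δ`. -/
theorem le_card_box {m n r δ : ℕ} (hm : 1 ≤ m) (hδ : δ < n) (d a : Fin m → ℕ) (hd : ∀ i, 0 < d i)
    (hdr : ∏ i, d i = r) (ha : ∑ i, a i ≤ δ) :
    r * n ^ (m - 1) * (n - δ) ≤ ∏ i, (n * d i - a i) := by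
  have han : ∀ i, a i ≤ n := fun i =>
    (Finset.single_le_sum (fun _ _ => Nat.zero_le _) (Finset.mem_univ i)).trans (ha.trans hδ.le)
  have h1 : n ^ (m - 1) * (n - δ) ≤ ∏ i, (n - a i) := by
    have h := pow_mul_sub_sum_le_prod_sub Finset.univ (n : ℤ) (by positivity) (fun i => (a i : ℤ))
      (fun _ _ => by positivity) (by exact_mod_cast ha.trans hδ.le)
    rw [Finset.card_univ, Fintype.card_fin] at h
    have hcast : ∏ i, ((n : ℤ) - a i) = ((∏ i, (n - a i) : ℕ) : ℤ) := by
      rw [Nat.cast_prod]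
      exact Finset.prod_congr rfl fun i _ => (Nat.cast_sub (han i)).symm
    have ha' : (∑ i, (a i : ℤ)) ≤ δ := by exact_mod_cast ha
    have h2 : (n : ℤ) ^ m * (n - δ) ≤ n * ∏ i, ((n : ℤ) - a i) :=
      (mul_le_mul_of_nonneg_left (by linarith) (by positivity)).trans h
    rw [hcast, ← Nat.cast_sub hδ.le] at h2
    have h3 : n ^ m * (n - δ) ≤ n * ∏ i, (n - a i) := by exact_mod_cast h2
    obtain ⟨k, rfl⟩ := Nat.exists_eq_add_of_le hm
    rw [pow_add, pow_one, mul_assoc] at h3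
    simpa using Nat.le_of_mul_le_mul_left h3 (by omega)
  calc r * n ^ (m - 1) * (n - δ) ≤ r * ∏ i, (n - a i) := by
        rw [mul_assoc]; exact Nat.mul_le_mul_left _ h1
    _ = ∏ i, d i * (n - a i) := by rw [← hdr, Finset.prod_mul_distrib]
    _ ≤ ∏ i, (n * d i - a i) := Finset.prod_le_prod' fun i _ => by
        rw [Nat.mul_sub, mul_comm]
        exact Nat.sub_le_sub_left (Nat.le_mul_of_pos_left _ (hd i)) _

/-- The exponents of the monomials of degree at most `δ` in `m` variables. -/
def degreeFinset (m δ : ℕ) : Finset (Fin m → ℕ) :=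
  (Finset.finsuppAntidiag (Finset.univ : Finset (Fin (m + 1))) δ).image fun f i => f i.succ

theorem mem_degreeFinset {m δ : ℕ} {v : Fin m → ℕ} : v ∈ degreeFinset m δ ↔ ∑ i, v i ≤ δ := by
  simp only [degreeFinset, Finset.mem_image, Finset.mem_finsuppAntidiag, Fin.sum_univ_succ]
  constructor
  · rintro ⟨f, ⟨hf, -⟩, rfl⟩
    exact hf ▸ Nat.le_add_left _ _
  · intro h
    -- Coordinate 0 is a slack variable that brings the total degree to exactly δ.
    refine ⟨Finsupp.equivFunOnFinite.symm (Fin.cons (δ - ∑ i, v i) v), ⟨?_, Finset.subset_univ _⟩, ?_⟩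
    · simpa using Nat.sub_add_cancel h
    · ext i; simp

theorem card_degreeFinset (m δ : ℕ) : (degreeFinset m δ).card = (δ + m).choose δ := by
  rw [degreeFinset, Finset.card_image_of_injOn, Finset.card_finsuppAntidiag_nat_eq_choose,
    Finset.card_univ, Fintype.card_fin]
  · congr 1; omega
  · intro f hf g hg h
    simp only [Finset.mem_coe, Finset.mem_finsuppAntidiag, Fin.sum_univ_succ] at hf hg
    have h' : ∀ i : Fin m, f i.succ = g i.succ := congrFun h
    ext i
    refine Fin.cases ?_ h' i
    have h1 := hf.1.trans hg.1.symm
    simpa only [h', add_left_inj] using h1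

/-! ## Triangular families are linearly independent -/

theorem linearIndependent_of_triangular {ι K V : Type*} [LinearOrder ι] [Field K] [AddCommGroup V]
    [Module K V] (P : ι → V) (φ : ι → V →ₗ[K] K) (h0 : ∀ i, φ i (P i) ≠ 0)
    (h : ∀ i j, j < i → φ i (P j) = 0) : LinearIndependent K P := by
  rw [linearIndependent_iff']
  classical
  intro s g hs
  by_contra! hne
  obtain ⟨i, hi, hmax⟩ := (s.filter fun i => g i ≠ 0).exists_max_image id
    (by obtain ⟨i, hi, hgi⟩ := hne; exact ⟨i, Finset.mem_filter.2 ⟨hi, hgi⟩⟩)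
  rw [Finset.mem_filter] at hi
  have h1 := congrArg (φ i) hs
  rw [map_sum, map_zero, Finset.sum_eq_single_of_mem i hi.1, map_smul, smul_eq_mul] at h1
  · exact (mul_ne_zero hi.2 (h0 i)) h1
  · intro j hj hji
    by_cases hgj : g j = 0
    · simp [hgj]
    · rw [map_smul, h i j (lt_of_le_of_ne (hmax j (Finset.mem_filter.2 ⟨hj, hgj⟩)) hji), smul_zero]

/-- Shifts of an element with leading exponent `a` are linearly independent as long as their leading
exponents are reduced. -/
theorem linearIndependent_shift {Γ K V : Type*} [LinearOrder Γ] [Add Γ]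
    [AddLeftStrictMono Γ] [AddRightStrictMono Γ] [Field K] [AddCommGroup V] [Module K V]
    (E : Γ → V) (D : Set Γ) (hD : LinearIndependent K fun x : D => E x)
    (hE : ∀ v, ∃ w ∈ D, w ≤ v ∧ E v = E w) (S : Finset Γ) (c : Γ → Γ → K) (a : Γ) (ha : a ∈ S)
    (hc : ∀ u, c u a ≠ 0) (hS : ∀ b ∈ S, b ≤ a) :
    LinearIndependent K fun u : {u // u + a ∈ D} => ∑ b ∈ S, c u b • E (u + b) := by
  classical
  -- T reads off coordinates in the independent family indexed by D; the functional paired with u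
  -- will be the coordinate at u + a.
  obtain ⟨T, hT⟩ := (Finsupp.linearCombination K fun x : D => E x).exists_leftInverse_of_injective
    (linearIndependent_iff_injective_finsuppLinearCombination.1 hD |> LinearMap.ker_eq_bot.2)
  have hTE : ∀ x : D, T (E x) = Finsupp.single x 1 := fun x => by
    have := LinearMap.congr_fun hT (Finsupp.single x 1)
    simpa using this
  have hTlt : ∀ (x : D) (v : Γ), v < x → T (E v) x = 0 := fun x v hv => by
    obtain ⟨w, hwD, hwv, hEw⟩ := hE v
    rw [hEw, hTE ⟨w, hwD⟩, Finsupp.single_apply, if_neg]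
    rintro rfl
    exact absurd (hwv.trans_lt hv) (lt_irrefl _)
  refine linearIndependent_of_triangular _
    (fun u => Finsupp.lapply ⟨u + a, u.2⟩ ∘ₗ T) (fun u => ?_) fun u v hvu => ?_
  · simp only [LinearMap.comp_apply, map_sum, map_smul, Finsupp.lapply_apply]
    rw [Finset.sum_eq_single_of_mem a ha, hTE ⟨u + a, u.2⟩, Finsupp.single_eq_same]
    · simpa using hc u
    · intro b hb hba
      rw [hTlt _ _ (add_lt_add_right (lt_of_le_of_ne (hS b hb) hba) _), smul_zero]
  · simp only [LinearMap.comp_apply, map_sum, map_smul, Finsupp.lapply_apply]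
    refine Finset.sum_eq_zero fun b hb => ?_
    rw [hTlt, smul_zero]
    have h1 : (v : Γ) + a < (u : Γ) + a := add_lt_add_left (Subtype.coe_lt_coe.2 hvu) _
    rcases (hS b hb).eq_or_lt with rfl | h
    · exact h1
    · exact (add_lt_add_right h _).trans h1

/-! ### Sum-rank weight and left multiples -/

namespace SumRank

variable {F K H : Type*} [Field F] [Field K] [Algebra F K] [FiniteDimensional F K] [Fintype H]

/-- The `K`-span of the left multiples of `φ` has dimension at most the weight of `φ`. -/
theorem card_le_weight (φ : H → Module.End F K) {ι : Type*} [Fintype ι]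
    (ψ : ι → H → Module.End F K) (hψ : LinearIndependent K fun u => ψ u * φ) :
    Fintype.card ι ≤ weight φ := by
  -- A left multiple ψφ depends only on the restrictions of ψ to the images of the φ_i, so the
  -- family factors through a space of K-dimension ∑ rk φ_i.
  let T : (∀ i, LinearMap.range (φ i) →ₗ[F] K) →ₗ[K] (H → Module.End F K) :=
    { toFun := fun g i => g i ∘ₗ (φ i).rangeRestrict
      map_add' := fun _ _ => rfl
      map_smul' := fun _ _ => rfl }
  have h1 : (fun u => ψ u * φ) = T ∘ fun u i => ψ u i ∘ₗ (LinearMap.range (φ i)).subtype := rfl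
  rw [h1] at hψ
  have h2 := (LinearIndependent.of_comp T hψ).fintype_card_le_finrank
  rw [finrank_pi_fintype] at h2
  simpa [weight, finrank_linearMap_self] using h2

end SumRank

/-! ### Congruence and independence of monomial codewords -/

namespace Ore

section

variable {F K : Type*} [Field F] [Fintype F] [Field K] [Algebra F K] [FiniteDimensional F K]
variable {m : ℕ} {e : Fin m → ℤ}

theorem frob_zpow_eq_one_iff {a : ℤ} : frob F K ^ a = 1 ↔ (finrank F K : ℤ) ∣ a := by
  have : Finite K := Module.finite_of_finite F
  rw [← FiniteField.orderOf_frobeniusAlgEquivOfAlgebraic F K, orderOf_dvd_iff_zpow_eq_one]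

theorem frob_zpow_of_mem_lattice {u : Fin m → ℤ} (hu : u ∈ lattice F K e) :
    frob F K ^ (e ⬝ᵥ u) = 1 := frob_zpow_eq_one_iff.2 hu

/-- The value of a prolongation on a translate by an element of the lattice. -/
theorem Prolongation.toFun_add {γ : Character F K e} (γ' : Prolongation γ) (l : lattice F K e)
    (v : Fin m → ℤ) : (γ'.toFun (l + v) : K) =
      algebraMap F K (γ (Multiplicative.ofAdd l) : F) * γ'.toFun v := by
  rw [γ'.cocycle, γ'.extends_char, frob_zpow_of_mem_lattice l.2, AlgEquiv.one_apply]

omit [FiniteDimensional F K] in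
/-- The characters of `L` separate the points of `L / (q - 1) L`. -/
theorem exists_smul_eq_of_forall_character_eq_one (l : lattice F K e)
    (h : ∀ γ : Character F K e, γ (Multiplicative.ofAdd l) = 1) :
    ∃ l' : lattice F K e, l = ((Fintype.card F - 1 : ℕ) : ℤ) • l' := by
  classical
  obtain ⟨g, hg⟩ := IsCyclic.exists_generator (α := Fˣ)
  have hord : orderOf g = Fintype.card F - 1 := by
    rw [orderOf_eq_card_of_forall_mem_zpowers hg, Nat.card_eq_fintype_card, Fintype.card_units]
  let B := Module.Free.chooseBasis ℤ (AddSubgroup.toIntSubmodule (lattice F K e))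
  have hdvd : ∀ i, ((Fintype.card F - 1 : ℕ) : ℤ) ∣ B.repr l i := fun i => by
    -- Sending l to g raised to its i-th coordinate is a character of L, and g has order q - 1.
    have h1 := h ((zpowersHom Fˣ g).comp (AddMonoidHom.toMultiplicative (B.coord i).toAddMonoidHom))
    have h2 : g ^ (B.repr l i) = 1 := h1
    rwa [← orderOf_dvd_iff_zpow_eq_one, hord] at h2
  choose c hc using hdvd
  refine ⟨∑ i, c i • B i, ?_⟩
  have h3 := B.sum_repr l
  simp only [hc, mul_smul, ← Finset.smul_sum] at h3
  exact h3.symm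

variable (γ' : ∀ γ : Character F K e, Prolongation γ)

/-- The codeword attached to the monomial `X^u`. -/
def monomialEval (u : Fin m → ℤ) : Character F K e → Module.End F K :=
  multiEval γ' (term F K e u 1)

theorem monomialEval_apply (u : Fin m → ℤ) (γ : Character F K e) (x : K) :
    monomialEval γ' u γ x = (γ' γ).toFun u * (frob F K ^ (e ⬝ᵥ u)) x := by
  rw [monomialEval, multiEval, LinearMap.pi_apply, eval_term, one_mul]

theorem monomialEval_smul_add (l : lattice F K e) (v : Fin m → ℤ) :
    monomialEval γ' (((Fintype.card F - 1 : ℕ) : ℤ) • (l : Fin m → ℤ) + v) = monomialEval γ' v := by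
  classical
  ext γ x
  have h : γ (Multiplicative.ofAdd (((Fintype.card F - 1 : ℕ) : ℤ) • l)) = 1 := by
    rw [ofAdd_zsmul, map_zpow, zpow_natCast, ← Fintype.card_units, pow_card_eq_one]
  have h2 := (γ' γ).toFun_add (((Fintype.card F - 1 : ℕ) : ℤ) • l) v
  rw [h, Units.val_one, map_one, one_mul] at h2
  rw [monomialEval_apply, monomialEval_apply, dotProduct_add, zpow_add]
  have h3 := frob_zpow_of_mem_lattice (((Fintype.card F - 1 : ℕ) : ℤ) • l).2
  rw [AddSubgroup.coe_zsmul] at h2 h3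
  rw [h2, h3, one_mul]

/-- Monomials that are pairwise incongruent modulo `(q - 1) L` have linearly independent images. -/
theorem linearIndependent_monomialEval {ι : Type*} (v : ι → Fin m → ℤ)
    (hv : ∀ i j, ∀ l ∈ lattice F K e, v i = ((Fintype.card F - 1 : ℕ) : ℤ) • l + v j → i = j) :
    LinearIndependent K fun i => monomialEval γ' (v i) := by
  classical
  rw [linearIndependent_iff']
  intro s a hs i₀ hi₀
  let σ : ι → (K ≃ₐ[F] K) := fun i => frob F K ^ (e ⬝ᵥ v i)
  have hL : ∀ i, σ i = σ i₀ → v i - v i₀ ∈ lattice F K e := fun i hi => by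
    change (finrank F K : ℤ) ∣ e ⬝ᵥ (v i - v i₀)
    rw [← frob_zpow_eq_one_iff, dotProduct_sub, zpow_sub, mul_inv_eq_one]
    exact hi
  -- Independence of the automorphisms of K isolates the terms sharing the automorphism of i₀; their
  -- exponents differ from v i₀ by elements of L.
  have hσ : ∀ γ : Character F K e,
      ∑ i ∈ s with σ i = σ i₀, a i * ((γ' γ).toFun (v i) : K) = 0 := by
    intro γ
    have hind : LinearIndependent K fun τ : K ≃ₐ[F] K => τ.toAlgHom.toLinearMap :=
      (linearIndependent_algHom_toLinearMap F K K).comp _ AlgEquiv.coe_toAlgHom_injective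
    refine Fintype.linearIndependent_iff.1 hind
      (fun τ => ∑ i ∈ s with σ i = τ, a i * ((γ' γ).toFun (v i) : K)) ?_ (σ i₀)
    simp only [Finset.sum_smul]
    rw [← Finset.sum_fiberwise s σ] at hs
    ext x
    have h := LinearMap.congr_fun (congrFun hs γ) x
    simp only [Finset.sum_apply, LinearMap.sum_apply, Pi.smul_apply, LinearMap.smul_apply,
      monomialEval_apply, LinearMap.zero_apply, Pi.zero_apply, smul_eq_mul] at h ⊢
    rw [← h]
    refine Finset.sum_congr rfl fun τ _ => Finset.sum_congr rfl fun i hi => ?_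
    rw [← (Finset.mem_filter.1 hi).2, mul_assoc]
    rfl
  let J := {i // σ i = σ i₀}
  -- Roles are exchanged: points of L become characters of H. They are distinct because incongruent
  -- points modulo (q - 1)L are separated by H.
  let f : J → (Character F K e →* K) := fun i =>
    (((algebraMap F K : F →* K).comp (Units.coeHom F)).comp
      (MonoidHom.eval (Multiplicative.ofAdd (⟨_, hL i i.2⟩ : lattice F K e))))
  have hf : Function.Injective f := by
    intro i j hij
    have hγ : ∀ γ : Character F K e, γ (Multiplicative.ofAdd
        ((⟨_, hL i i.2⟩ : lattice F K e) - ⟨_, hL j j.2⟩)) = 1 := fun γ => by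
      have h1 : algebraMap F K (γ (Multiplicative.ofAdd (⟨_, hL i i.2⟩ : lattice F K e)) : F) =
        algebraMap F K (γ (Multiplicative.ofAdd (⟨_, hL j j.2⟩ : lattice F K e)) : F) :=
        DFunLike.congr_fun hij γ
      rw [ofAdd_sub, map_div, div_eq_one]
      exact Units.ext ((algebraMap F K).injective h1)
    obtain ⟨l', hl'⟩ := exists_smul_eq_of_forall_character_eq_one _ hγ
    refine Subtype.ext (hv i j l' l'.2 ?_)
    have h2 := congrArg Subtype.val hl'
    rw [AddSubgroup.coe_sub, AddSubgroup.coe_zsmul, sub_sub_sub_cancel_right] at h2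
    exact sub_eq_iff_eq_add.1 h2
  have hlin := (linearIndependent_monoidHom (Character F K e) K).comp f hf
  rw [linearIndependent_iff'] at hlin
  refine hlin (s.subtype _) (fun i => a i) ?_ ⟨i₀, rfl⟩ (Finset.mem_subtype.2 hi₀)
  ext γ
  have h := hσ γ
  rw [← Finset.sum_subtype_eq_sum_filter] at h
  -- The choice of prolongation only contributes the common nonzero factor at v i₀.
  have h4 : ∀ i : J, ((γ' γ).toFun (v i) : K) = f i γ * (γ' γ).toFun (v i₀) := fun i => by
    have := (γ' γ).toFun_add ⟨_, hL i i.2⟩ (v i₀)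
    rwa [sub_add_cancel] at this
  simp only [h4, ← mul_assoc, ← Finset.sum_mul] at h
  simpa using h

/-! ### The code as a span of monomial codewords -/

omit [Field F] [Fintype F] [Algebra F K] [FiniteDimensional F K] in
theorem term_mem_degreeLE {b : Fin m → ℕ} {δ : ℕ} (hb : ∑ i, b i ≤ δ) (a : K) :
    term F K e (intVec b) a ∈ degreeLE F K e δ := by
  classical
  intro u hu
  have hub : u = intVec b := by
    by_contra hne
    refine hu ?_
    unfold coeff term
    rw [SkewMonoidAlgebra.coeff_single_apply, if_neg]
    exact fun h => hne (Multiplicative.ofAdd.injective h).symm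
  subst hub
  exact ⟨fun i => Int.natCast_nonneg _, by simpa [intVec] using mod_cast hb⟩

omit [Field F] [Fintype F] [Algebra F K] [FiniteDimensional F K] in
theorem eq_sum_of_mem_degreeLE {f : Laurent F K e} {δ : ℕ} (hf : f ∈ degreeLE F K e δ) :
    f = ∑ b ∈ degreeFinset m δ, coeff F K e f (intVec b) • term F K e (intVec b) 1 := by
  classical
  refine SkewMonoidAlgebra.ext fun u => ?_
  have hsum : ∀ (s : Finset (Fin m → ℕ)) (g : (Fin m → ℕ) → Laurent F K e),
      (∑ b ∈ s, g b).coeff u = ∑ b ∈ s, (g b).coeff u := fun s g => by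
    induction s using Finset.induction_on with
    | empty => simp
    | insert b s hb ih => rw [Finset.sum_insert hb, Finset.sum_insert hb, ← ih]; simp
  have hterm : ∀ b : Fin m → ℕ, (coeff F K e f (intVec b) • term F K e (intVec b) 1).coeff u =
      if Multiplicative.ofAdd (intVec b) = u then coeff F K e f (intVec b) else 0 := fun b => by
    unfold term
    rw [SkewMonoidAlgebra.smul_single, SkewMonoidAlgebra.coeff_single_apply, smul_eq_mul, mul_one]
    rfl
  rw [hsum]
  simp only [hterm]
  by_cases hu : f.coeff u = 0
  · rw [hu]
    refine (Finset.sum_eq_zero fun b _ => ?_).symm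
    split_ifs with h
    · subst h; exact hu
    · rfl
  · obtain ⟨h0, hδ⟩ := hf (Multiplicative.toAdd u) hu
    let b : Fin m → ℕ := fun i => (Multiplicative.toAdd u i).toNat
    have hb : intVec b = Multiplicative.toAdd u := funext fun i => Int.toNat_of_nonneg (h0 i)
    have hbδ : ∑ i, b i ≤ δ := by
      have h1 : ∑ i, (b i : ℤ) ≤ δ := by
        rw [← hb] at hδ
        exact hδ
      exact_mod_cast h1
    rw [Finset.sum_eq_single_of_mem b (mem_degreeFinset.2 hbδ), if_pos]
    · rw [hb]; rfl
    · rw [hb]; rfl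
    · intro c _ hcb
      rw [if_neg]
      rintro rfl
      exact hcb (intVec_injective hb.symm)

theorem multiEval_eq_sum {f : Laurent F K e} {δ : ℕ} (hf : f ∈ degreeLE F K e δ) :
    multiEval γ' f = ∑ b ∈ degreeFinset m δ, coeff F K e f (intVec b) •
      monomialEval γ' (intVec b) := by
  conv_lhs => rw [eq_sum_of_mem_degreeLE hf, map_sum]
  exact Finset.sum_congr rfl fun b _ => map_smul _ _ _

theorem LRM_eq_span (δ : ℕ) : LRM γ' δ =
    Submodule.span K (Set.range fun b : degreeFinset m δ => monomialEval γ' (intVec b)) := by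
  apply le_antisymm
  · rintro _ ⟨f, hf, rfl⟩
    rw [multiEval_eq_sum γ' hf]
    exact Submodule.sum_mem _ fun b hb =>
      Submodule.smul_mem _ _ (Submodule.subset_span ⟨⟨b, hb⟩, rfl⟩)
  · rw [Submodule.span_le]
    rintro _ ⟨b, rfl⟩
    exact ⟨_, term_mem_degreeLE (mem_degreeFinset.1 b.2) 1, rfl⟩

/-- The cocycle condition is what makes left multiplication by a monomial a Frobenius-twisted shift
of exponents. -/
theorem monomialEval_mul_smul (u v : Fin m → ℤ) (c : K) :
    monomialEval γ' u * (c • monomialEval γ' v) =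
      (frob F K ^ (e ⬝ᵥ u)) c • monomialEval γ' (u + v) := by
  ext γ x
  change monomialEval γ' u γ (c * monomialEval γ' v γ x) =
    (frob F K ^ (e ⬝ᵥ u)) c * monomialEval γ' (u + v) γ x
  simp only [monomialEval_apply, (γ' γ).cocycle, dotProduct_add, zpow_add, AlgEquiv.mul_apply,
    map_mul]
  ring

/-! ### Dimension and minimum distance -/

theorem finrank_LRM {δ : ℕ} (hδ : δ + 2 ≤ Fintype.card F) :
    finrank K (LRM γ' δ) = (δ + m).choose δ := by
  rw [LRM_eq_span, finrank_span_eq_card, Fintype.card_coe, card_degreeFinset]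
  refine linearIndependent_monomialEval γ' _ fun v w l _ hl => Subtype.ext ?_
  have hlt : ∀ u : degreeFinset m δ, ∀ i, u.1 i < (Fintype.card F - 1) * 1 := fun u i => by
    have := Finset.single_le_sum (f := u.1) (fun _ _ => Nat.zero_le _) (Finset.mem_univ i)
    have := mem_degreeFinset.1 u.2
    omega
  -- All entries are at most δ < q - 1, so the exponents are already incongruent modulo (q - 1)ℤ^m,
  -- which contains (q - 1)L.
  exact eq_of_sub_mem_of_lt ⊤ (fun _ => 1) (fun _ _ _ _ => by simp) (hlt v) (hlt w)
    (AddSubgroup.mem_top l) hl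

/-- A footprint argument: count the shifts of f whose leading exponent stays in the box of
representatives modulo (q - 1)L. -/
theorem le_weight (hm : 1 ≤ m)
    (he : Int.gcd (Finset.univ.gcd e) (finrank F K : ℤ) = 1) {δ : ℕ}
    (hδ : δ + 2 ≤ Fintype.card F) {φ : Character F K e → Module.End F K} (hφ : φ ∈ LRM γ' δ)
    (h0 : φ ≠ 0) :
    finrank F K * (Fintype.card F - 1) ^ (m - 1) * (Fintype.card F - 1 - δ) ≤ SumRank.weight φ := by
  classical
  obtain ⟨f, hf, rfl⟩ := hφ
  have hr : 0 < finrank F K := finrank_pos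
  obtain ⟨d, g, hd, hg, -, hb, hu⟩ := exists_triangular_diagonal hr e
  have hgr : (g : ℤ) ∣ finrank F K := by exact_mod_cast Dvd.intro_left _ hd
  have hg1 : g = 1 := by
    have := Int.dvd_coe_gcd (Finset.dvd_gcd (s := Finset.univ) fun i _ => hg i) hgr
    rw [he] at this
    exact_mod_cast Int.eq_one_of_dvd_one (by positivity) this
  rw [hg1, mul_one] at hd
  have hd0 : ∀ i, 0 < d i := fun i => Nat.pos_of_ne_zero fun h =>
    hr.ne' (hd ▸ Finset.prod_eq_zero (Finset.mem_univ i) h)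
  let n := Fintype.card F - 1
  have hn : 0 < n := by omega
  let E : Lex (Fin m → ℕ) → Character F K e → Module.End F K :=
    fun v => monomialEval γ' (intVec (ofLex v))
  let D : Set (Lex (Fin m → ℕ)) := {v | ∀ i, ofLex v i < n * d i}
  have hD : LinearIndependent K fun x : D => E x :=
    linearIndependent_monomialEval γ' _ fun v w l hl h => Subtype.ext
      (eq_of_sub_mem_of_lt (lattice F K e) d hu v.2 w.2 hl h)
  have hE : ∀ v, ∃ w ∈ D, w ≤ v ∧ E v = E w := fun v => by
    obtain ⟨w, hwD, hwv, l, hl, h⟩ := exists_lex_reduction hr hn (lattice F K e)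
      (fun u => show _ ∣ e ⬝ᵥ _ by rw [dotProduct_smul]; exact ⟨_, rfl⟩) d hd0 hb v
    refine ⟨w, hwD, hwv, ?_⟩
    change monomialEval γ' _ = _
    rw [h]
    exact monomialEval_smul_add γ' ⟨l, hl⟩ _
  let c : (Fin m → ℕ) → K := fun b => coeff F K e f (intVec b)
  let S : Finset (Lex (Fin m → ℕ)) :=
    ((degreeFinset m δ).filter fun b => c b ≠ 0).map toLex.toEmbedding
  have hfS : multiEval γ' f = ∑ b ∈ S, c (ofLex b) • E b := by
    rw [multiEval_eq_sum γ' hf, Finset.sum_map, Finset.sum_filter]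
    refine Finset.sum_congr rfl fun b _ => ?_
    split_ifs with h
    · rfl
    · exact (congrArg (· • monomialEval γ' (intVec b)) (not_not.1 h)).trans (zero_smul _ _)
  have hS : S.Nonempty := Finset.nonempty_iff_ne_empty.2 fun h => h0 (by
    change multiEval γ' f = 0
    rw [hfS, h, Finset.sum_empty])
  -- a is the lexicographically leading exponent of f; its degree is still at most δ, which is all
  -- the count needs.
  obtain ⟨a, haS, hmax⟩ := S.exists_max_image id hS
  obtain ⟨a', ha', rfl⟩ := Finset.mem_map.1 haS
  rw [Finset.mem_filter, mem_degreeFinset] at ha'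
  have hlin := linearIndependent_shift E D hD hE S
    (fun u b => (frob F K ^ (e ⬝ᵥ intVec (ofLex u))) (c (ofLex b))) (toLex a') haS
    (fun u => (map_ne_zero _).2 ha'.2) hmax
  have hmul : ∀ u : Lex (Fin m → ℕ), ∑ b ∈ S, (frob F K ^ (e ⬝ᵥ intVec (ofLex u))) (c (ofLex b)) •
      E (u + b) = E u * multiEval γ' f := fun u => by
    rw [hfS, Finset.mul_sum]
    refine Finset.sum_congr rfl fun b _ => ?_
    change _ • monomialEval γ' (intVec (ofLex u + ofLex b)) = _
    rw [intVec_add]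
    exact (monomialEval_mul_smul γ' _ _ _).symm
  simp only [hmul] at hlin
  let U : Finset (Fin m → ℕ) := Fintype.piFinset fun i => Finset.range (n * d i - a' i)
  have hU : ∀ u : U, toLex u.1 + toLex a' ∈ D := fun u i => by
    have := Finset.mem_range.1 (Fintype.mem_piFinset.1 u.2 i)
    exact Nat.add_lt_of_lt_sub this
  have hcard := SumRank.card_le_weight (multiEval γ' f) (fun u : U => E (toLex u.1))
    (hlin.comp (fun u : U => ⟨toLex u.1, hU u⟩) fun u v h =>
      Subtype.ext (toLex.injective (Subtype.mk.inj h)))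
  refine le_trans ?_ hcard
  rw [Fintype.card_coe, Fintype.card_piFinset]
  simp only [Finset.card_range]
  exact le_card_box hm (by omega) d a' hd0 hd ha'.1

end

end Ore

theorem mainTheorem2 {F K : Type*} [Field F] [Fintype F] [Field K] [Algebra F K]
    [FiniteDimensional F K] {m : ℕ} (hm : 1 ≤ m) (e : Fin m → ℤ)
    (he : Int.gcd (Finset.univ.gcd e) (Module.finrank F K : ℤ) = 1)
    (γ' : ∀ γ : Ore.Character F K e, Ore.Prolongation γ)
    (δ : ℕ) (hδ : 1 ≤ δ) (hδq : δ + 2 ≤ Fintype.card F) :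
    Module.finrank K (Ore.LRM γ' δ) = (δ + m).choose δ ∧
      Module.finrank F K * (Fintype.card F - 1) ^ (m - 1) * (Fintype.card F - 1 - δ)
        ≤ SumRank.minDist (Ore.LRM γ' δ) := by
  have hk := Ore.finrank_LRM γ' hδq
  refine ⟨hk, le_csInf ?_ ?_⟩
  -- The infimum of an empty set of naturals is 0, so a nonzero codeword must be exhibited; the
  -- dimension is a positive binomial coefficient.
  · have hne : Ore.LRM γ' δ ≠ ⊥ := fun h => by
      rw [h, finrank_bot] at hk
      exact (Nat.choose_pos (Nat.le_add_right δ m)).ne hk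
    obtain ⟨φ, hφ, h0⟩ := Submodule.exists_mem_ne_zero_of_ne_bot hne
    exact ⟨_, φ, hφ, h0, rfl⟩
  · rintro _ ⟨φ, hφ, h0, rfl⟩
    exact Ore.le_weight γ' hm he hδq hφ h0

end
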